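/- Let $K$ be a field and let $\mathcal O\subseteq K$ be either the interval $[-1,1]$ for a total order making $K$ an ordered field, or the valuation ring of a non-trivial valuation on $K$. Put $\mathcal O^\times=\{a\in\mathcal O\setminus\{0\}: a^{-1}\in\mathcal O\}$ and let $v:K^\times\to v(K^\times)=K^\times/\mathcal O^\times$ be the residue map, where $v(K^\times)$ is written additively and is ordered by $v(x)\le v(y)\iff y\in x\mathcal O$. For $x,y\in K$ write $|y|\le|x|$ if $y\in x\mathcal O$, and $|y|<|x|$ if moreover $x\notin y\mathcal O$; give $K$ the topology generated by the open balls $\{x: |x-c|<|r|\}$ with $c\in K$, $r\in K^\times$. Let $\mathcal K$ be an expansion of $(K,\mathcal O)$, i.e. a first-order structure on $K$ in a language containing the language of rings and a unary predicate for $\mathcal O$, all with their usual interpretation. Definable means first-order definable with parameters: in $\mathcal K$ for subsets of $K^m$, and in the language $\{0,+,\le\}$ of ordered groups for subsets of $v(K^\times)$. For definable $X\subseteq K$ let $\mathcal C(X)$ be the set of continuous definable functions $X\to K$. For a definable $X\subseteq K$ and $p_0\in X$, we say that $X$ has *arbitrarily many germs* at $p_0$ if for every integer $k\ge1$ there are a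 definable neighborhood $N$ of $p_0$ in $X$, functions $s_1,\dots,s_k\in\mathcal C(N)$ and functions $\delta_1,\dots,\delta_k\in\mathcal C(N\setminus\{p_0\})$ such that, writing $S_i=\{x\in N: s_i(x)=0\}\setminus\{p_0\}$: 1. the sets $S_i$ are pairwise disjoint; 2. $p_0$ is a non-isolated zero of each $s_i$; 3. for $i\ne j$, $\delta_i$ is constantly $1$ on $S_i$ and constantly $0$ on $S_j$; 4. each $\delta_i$ is bounded on $N\setminus\{p_0\}$, i.e. there is $r\in K$ with $|\delta_i(x)|\le|r|$ for all $x\in N\setminus\{p_0\}$. We say that $\mathcal K$ satisfies (Z) if $v(K^\times)$ is elementarily equivalent to $(\mathbb Z,+,\le)$ as an ordered group (i.e. it is a $\mathbb Z$-group) and for every definable set $X\subseteq K^\times$ the set $v(X)$ is definable in $v(K^\times)$. **Proposition.** If $\mathcal K$ satisfies (Z), then every definable open subset $U$ of $K$ has arbitrarily many germs at every point of $U$. -/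

import Mathlib

open FirstOrder Topology

/-- The "unit ball" `𝒪` of an ordered or valued field `K`: either the interval `[-1, 1]` of a total
order making `K` an ordered field, or the ring of a non-trivial valuation of `K`. -/
structure UnitBall (K : Type*) [Field K] where
  carrier : Set K
  ordered_or_valued :
    (∃ _ : LinearOrder K, IsStrictOrderedRing K ∧ carrier = Set.Icc (-1 : K) 1) ∨
      (∃ A : ValuationSubring K, A ≠ ⊤ ∧ carrier = (A : Set K))

namespace UnitBall

variable {K : Type*} [Field K] (B : UnitBall K)

theorem one_mem : (1 : K) ∈ B.carrier := by
  rcases B.ordered_or_valued with ⟨_, h, e⟩ | ⟨A, -, e⟩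
  · rw [e, Set.mem_Icc]
    exact ⟨by linarith [zero_lt_one (α := K)], le_rfl⟩
  · rw [e]
    exact A.one_mem

theorem mul_mem {a b : K} (ha : a ∈ B.carrier) (hb : b ∈ B.carrier) : a * b ∈ B.carrier := by
  rcases B.ordered_or_valued with ⟨_, h, e⟩ | ⟨A, -, e⟩
  · rw [e, Set.mem_Icc, ← abs_le] at ha hb ⊢
    rw [abs_mul]
    exact mul_le_one₀ ha (abs_nonneg b) hb
  · rw [e] at ha hb ⊢
    exact A.mul_mem _ _ ha hb

/-- `B.AbsLE y x` is the relation `|y| ≤ |x|`, i.e. `y ∈ x • 𝒪`. -/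
def AbsLE (y x : K) : Prop := ∃ a ∈ B.carrier, y = x * a

/-- `B.AbsLT y x` is the relation `|y| < |x|`. -/
def AbsLT (y x : K) : Prop := B.AbsLE y x ∧ ¬ B.AbsLE x y

/-- The open ball of center `c` and radius `r`, `{x | |x - c| < |r|}`. -/
def openBall (c r : K) : Set K := {x | B.AbsLT (x - c) r}

/-- The topology of `K` defined by the open balls with radius in `Kˣ`. -/
@[reducible] def topology : TopologicalSpace K :=
  TopologicalSpace.generateFrom {S | ∃ c r : K, r ≠ 0 ∧ S = B.openBall c r}

/-- The group `𝒪ˣ` of all non-zero `a ∈ 𝒪` with `a⁻¹ ∈ 𝒪`. -/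
def units : Subgroup Kˣ where
  carrier := {a | (a : K) ∈ B.carrier ∧ (a : K)⁻¹ ∈ B.carrier}
  one_mem' := by simp [B.one_mem]
  mul_mem' := by
    rintro a b ⟨ha, ha'⟩ ⟨hb, hb'⟩
    refine ⟨?_, ?_⟩
    · rw [Units.val_mul]
      exact B.mul_mem ha hb
    · rw [Units.val_mul, mul_inv]
      exact B.mul_mem ha' hb'
  inv_mem' := by
    rintro a ⟨ha, ha'⟩
    exact ⟨by simpa using ha', by simpa using ha⟩

/-- The group `v(Kˣ) = Kˣ / 𝒪ˣ`, written additively. -/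
def ValueGroup : Type _ := Additive (Kˣ ⧸ B.units)

instance : AddCommGroup B.ValueGroup := inferInstanceAs (AddCommGroup (Additive (Kˣ ⧸ B.units)))

/-- The residue map `v : Kˣ → Kˣ / 𝒪ˣ`. -/
def v (x : Kˣ) : B.ValueGroup := Additive.ofMul (x : Kˣ ⧸ B.units)

/-- The order of `v(Kˣ)`: `v x ≤ v y` if and only if `|y| ≤ |x|`. -/
instance : LE B.ValueGroup :=
  ⟨fun g h => ∃ x y : Kˣ, B.v x = g ∧ B.v y = h ∧ B.AbsLE (y : K) (x : K)⟩

end UnitBall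

/-- Function symbols of the language of ordered groups. -/
inductive OrderedGroupFunc : ℕ → Type
  | zero : OrderedGroupFunc 0
  | add : OrderedGroupFunc 2

/-- Relation symbols of the language of ordered groups. -/
inductive OrderedGroupRel : ℕ → Type
  | le : OrderedGroupRel 2

/-- The language `{0, +, ≤}` of (additive) ordered groups. -/
def orderedGroupLanguage : Language := ⟨OrderedGroupFunc, OrderedGroupRel⟩

/-- The structure `(G, 0, +, ≤)`. -/
instance orderedGroupStructure {G : Type*} [Zero G] [Add G] [LE G] :
    orderedGroupLanguage.Structure G where
  funMap := fun {_} f x => match f, x with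
    | .zero, _ => 0
    | .add, x => x 0 + x 1
  RelMap := fun {_} r x => match r, x with
    | .le, x => x 0 ≤ x 1

section Germs

variable {K : Type*} [Field K] (B : UnitBall K) (L : Language) [L.Structure K]

/-- Condition (Z): `v(Kˣ)` is elementarily equivalent to `(ℤ, +, ≤)`, and for every `L`-definable
(with parameters) `X ⊆ Kˣ`, the image `v(X)` is definable (with parameters) in the ordered group
`v(Kˣ)`. -/
def ConditionZ : Prop :=
  orderedGroupLanguage.ElementarilyEquivalent B.ValueGroup ℤ ∧
    ∀ X : Set K, (0 : K) ∉ X → (Set.univ : Set K).Definable₁ L X →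
      (Set.univ : Set B.ValueGroup).Definable₁ orderedGroupLanguage
        (B.v '' {x : Kˣ | (x : K) ∈ X})

/-- `f`, restricted to `X ⊆ K`, is an element of `𝒞(X)`: a continuous function `X → K` whose graph
is definable with parameters. The values of `f` outside `X` are irrelevant. -/
def MemC (X : Set K) (f : K → K) : Prop :=
  @ContinuousOn K K B.topology B.topology f X ∧
    (Set.univ : Set K).Definable₂ L {p : K × K | p.1 ∈ X ∧ f p.1 = p.2}

/-- `s : U → K` vanishes on a germ at `p₀`: it has a non-isolated zero at `p₀`. -/
def VanishesOnGerm (U : Set K) (s : K → K) (p₀ : K) : Prop :=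
  s p₀ = 0 ∧ @AccPt K B.topology p₀ (Filter.principal {x | x ∈ U ∧ s x = 0})

/-- `s₁, …, s_k` (functions in `𝒞(U)`) vanish on separated germs at `p₀`: there are separating
functions `δ₁, …, δ_k ∈ 𝒞(U \ {p₀})` such that the sets `Sᵢ = {sᵢ = 0} \ {p₀}` are pairwise
disjoint, each `sᵢ` vanishes on a germ at `p₀`, `δᵢ` is constantly `1` on `Sᵢ` and constantly `0` on
`Sⱼ` for `i ≠ j`, and each `δᵢ` is bounded on `U \ {p₀}`. -/
def VanishOnSeparatedGerms (U : Set K) (p₀ : K) {k : ℕ} (s : Fin k → K → K) : Prop :=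
  ∃ δ : Fin k → K → K,
    (∀ i, MemC B L (U \ {p₀}) (δ i)) ∧
    (∀ i j, i ≠ j →
      Disjoint ({x | x ∈ U ∧ s i x = 0} \ {p₀}) ({x | x ∈ U ∧ s j x = 0} \ {p₀})) ∧
    (∀ i, VanishesOnGerm B U (s i) p₀) ∧
    (∀ i j, i ≠ j →
      (∀ x ∈ {x | x ∈ U ∧ s i x = 0} \ {p₀}, δ i x = 1) ∧
      (∀ x ∈ {x | x ∈ U ∧ s j x = 0} \ {p₀}, δ i x = 0)) ∧
    (∀ i, ∃ r : K, ∀ x ∈ U \ {p₀}, B.AbsLE (δ i x) r)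

/-- `X ⊆ K` has arbitrarily many germs at `p₀ ∈ X`: for every `k ≥ 1` there are a definable
neighborhood `U` of `p₀` in `X` and `k` functions in `𝒞(U)` that vanish on separated germs at
`p₀`. -/
def HasArbitrarilyManyGerms (X : Set K) (p₀ : K) : Prop :=
  ∀ k : ℕ, 0 < k → ∃ U : Set K, U ⊆ X ∧ p₀ ∈ U ∧
    U ∈ @nhdsWithin K B.topology p₀ X ∧ (Set.univ : Set K).Definable₁ L U ∧
    ∃ s : Fin k → K → K, (∀ i, MemC B L U (s i)) ∧ VanishOnSeparatedGerms B L U p₀ s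

end Germs

/-! ### The value group and its order. -/

namespace UnitBall

variable {K : Type*} [Field K] (B : UnitBall K)

/-! A group elementarily equivalent to `ℤ` has a least positive element. The value group of an
ordered field has none, so `𝒪` is a valuation ring and some `π` has least positive value
(`exists_uniformizer`, `not_orderedField_of_uniformizer`).

Given `k`, sort the points `x ≠ p₀` by the class of `v (x - p₀)` modulo `k • v(Kˣ)`. The classes of
`i • v π` for `i < k` are distinct because `v π` is least positive (`disjoint_valuationClass`). Each
set `valuationClass A p₀ π k i` is definable, accumulates at `p₀`, and is clopen in `K \ {p₀}` since
the valuation of `x - p₀` is locally constant there. Hence its indicator function serves as `δᵢ`,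
and the function equal to `0` on it and to `x - p₀` elsewhere serves as `sᵢ`. The latter is
continuous also at `p₀`, being dominated by `x - p₀`. -/

theorem AbsLE.trans {B : UnitBall K} {x y z : K} (hxy : B.AbsLE x y) (hyz : B.AbsLE y z) :
    B.AbsLE x z := by
  obtain ⟨a, ha, rfl⟩ := hxy
  obtain ⟨b, hb, rfl⟩ := hyz
  exact ⟨b * a, B.mul_mem hb ha, mul_assoc _ _ _⟩

theorem v_eq_iff (x y : Kˣ) : B.v x = B.v y ↔ x⁻¹ * y ∈ B.units :=
  Additive.ofMul.injective.eq_iff.trans QuotientGroup.eq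

theorem absLE_of_v_eq {x y : Kˣ} (h : B.v x = B.v y) : B.AbsLE (y : K) x :=
  ⟨((x⁻¹ * y : Kˣ) : K), ((B.v_eq_iff x y).1 h).1, by simp⟩

theorem v_surjective : Function.Surjective B.v := fun g =>
  QuotientGroup.mk_surjective (s := B.units) (Additive.toMul g)

theorem v_one : B.v 1 = 0 := rfl

/-- The order asks only for some pair of representatives; others differ by units of `𝒪`, which are
absorbed on both sides by transitivity. -/
theorem v_le_v_iff (x y : Kˣ) : B.v x ≤ B.v y ↔ B.AbsLE (y : K) x := by
  refine ⟨?_, fun h => ⟨x, y, rfl, rfl, h⟩⟩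
  rintro ⟨a, b, ha, hb, h⟩
  exact (B.absLE_of_v_eq hb).trans (h.trans (B.absLE_of_v_eq ha.symm))

theorem zero_le_v_iff (x : Kˣ) : 0 ≤ B.v x ↔ (x : K) ∈ B.carrier := by
  rw [← v_one, v_le_v_iff]
  exact ⟨by rintro ⟨a, ha, h⟩; rw [h]; simpa using ha, fun h => ⟨x, h, by simp⟩⟩

theorem v_eq_zero_iff (x : Kˣ) :
    B.v x = 0 ↔ (x : K) ∈ B.carrier ∧ (x : K)⁻¹ ∈ B.carrier := by
  rw [← v_one, eq_comm, v_eq_iff, inv_one, one_mul]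
  rfl

end UnitBall

/-! ### The least positive value, and exclusion of the ordered case. -/

/-- The sentence "there is a smallest positive element" in the language of ordered groups. -/
def leastPositiveSentence : orderedGroupLanguage.Sentence :=
  let zero (n : ℕ) : orderedGroupLanguage.Term (Empty ⊕ Fin n) :=
    Language.Term.func OrderedGroupFunc.zero Fin.elim0
  let le {n : ℕ} (s t : orderedGroupLanguage.Term (Empty ⊕ Fin n)) :=
    Language.Relations.boundedFormula₂ (L := orderedGroupLanguage) OrderedGroupRel.le s t
  let var (n : ℕ) (i : Fin n) : orderedGroupLanguage.Term (Empty ⊕ Fin n) :=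
    Language.Term.var (Sum.inr i)
  ((le (zero 1) (var 1 0) ⊓ ∼((var 1 0).bdEqual (zero 1))) ⊓
    ((le (zero 2) (var 2 1) ⊓ ∼((var 2 1).bdEqual (zero 2))) ⟹ le (var 2 0) (var 2 1)).all).ex

theorem realize_leastPositiveSentence (G : Type*) [Zero G] [Add G] [LE G] :
    G ⊨ leastPositiveSentence ↔
      ∃ g : G, (0 ≤ g ∧ g ≠ 0) ∧ ∀ h : G, 0 ≤ h ∧ h ≠ 0 → g ≤ h := by
  simp only [leastPositiveSentence, Language.Sentence.Realize, Language.Formula.Realize,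
    Language.BoundedFormula.realize_ex, Language.BoundedFormula.realize_all,
    Language.BoundedFormula.realize_inf, Language.BoundedFormula.realize_imp,
    Language.BoundedFormula.realize_not, Language.BoundedFormula.realize_bdEqual]
  rfl

namespace UnitBall

variable {K : Type*} [Field K] (B : UnitBall K)

/-- Having a least positive element is a first-order property, so it transfers from `ℤ`, where `1`
is the witness. Positivity of `v x` is spelled out as `x ∈ 𝒪`, `x⁻¹ ∉ 𝒪`. -/
theorem exists_uniformizer
    (h : orderedGroupLanguage.ElementarilyEquivalent B.ValueGroup ℤ) :
    ∃ x : Kˣ, ((x : K) ∈ B.carrier ∧ (x : K)⁻¹ ∉ B.carrier) ∧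
      ∀ y : Kˣ, (y : K) ∈ B.carrier → (y : K)⁻¹ ∉ B.carrier → B.AbsLE (y : K) x := by
  have hG := (h.realize_sentence leastPositiveSentence).2
    ((realize_leastPositiveSentence ℤ).2 ⟨1, by norm_num, fun h hh => by omega⟩)
  obtain ⟨g, ⟨hg, hg0⟩, hmin⟩ := (realize_leastPositiveSentence _).1 hG
  obtain ⟨x, rfl⟩ := B.v_surjective g
  rw [zero_le_v_iff] at hg
  refine ⟨x, ⟨hg, fun h' => hg0 ((B.v_eq_zero_iff x).2 ⟨hg, h'⟩)⟩, fun y hy hy' => ?_⟩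
  exact (B.v_le_v_iff x y).1
    (hmin _ ⟨(B.zero_le_v_iff y).2 hy, fun e => hy' ((B.v_eq_zero_iff y).1 e).2⟩)

/-- The value group of an ordered field has no least positive element. -/
theorem not_orderedField_of_uniformizer [LinearOrder K] [IsStrictOrderedRing K]
    (hB : B.carrier = Set.Icc (-1 : K) 1) (x : Kˣ)
    (hx : (x : K) ∈ B.carrier) (hx' : (x : K)⁻¹ ∉ B.carrier)
    (hmin : ∀ y : Kˣ, (y : K) ∈ B.carrier → (y : K)⁻¹ ∉ B.carrier → B.AbsLE (y : K) x) :
    False := by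
  have hmem (a : K) : a ∈ B.carrier ↔ |a| ≤ 1 := by rw [hB, Set.mem_Icc, abs_le]
  rw [hmem] at hx hx'
  have hpos : 0 < |(x : K)| := abs_pos.2 x.ne_zero
  have hlt : |(x : K)| < 1 := by
    refine lt_of_le_of_ne hx fun h => hx' ?_
    rw [abs_inv, h, inv_one]
  -- The midpoint of `|x|` and `1` has positive value, yet lies strictly above `|x|`, against
  -- minimality.
  set y : K := (1 + |(x : K)|) / 2 with hy
  have hy0 : 0 < y := by rw [hy]; linarith
  have hy1 : y < 1 := by rw [hy]; linarith
  have hxy : |(x : K)| < y := by rw [hy]; linarith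
  obtain ⟨a, ha, hya⟩ := hmin (Units.mk0 y hy0.ne')
    (by rw [hmem, Units.val_mk0, abs_of_pos hy0]; exact hy1.le)
    (by
      rw [hmem, Units.val_mk0, abs_inv, abs_of_pos hy0, not_le]
      exact (one_lt_inv₀ hy0).2 hy1)
  rw [hmem] at ha
  rw [Units.val_mk0] at hya
  have h1 : y ≤ |(x : K)| := by
    rw [← abs_of_pos hy0, hya, abs_mul]
    exact mul_le_of_le_one_right hpos.le ha
  exact absurd h1 hxy.not_ge

/-! ### The valuation topology. -/

section Valued

variable {B} {A : ValuationSubring K} (hB : B.carrier = (A : Set K))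
include hB

theorem mem_carrier_iff (x : K) : x ∈ B.carrier ↔ A.valuation x ≤ 1 := by
  rw [hB, A.valuation_le_one_iff]
  rfl

theorem absLE_iff (x y : K) : B.AbsLE y x ↔ A.valuation y ≤ A.valuation x := by
  rw [A.valuation_le_iff, AbsLE, hB]
  constructor
  · rintro ⟨a, ha, rfl⟩
    exact ⟨⟨a, ha⟩, mul_comm _ _⟩
  · rintro ⟨a, rfl⟩
    exact ⟨a, a.2, mul_comm _ _⟩

theorem mem_openBall_iff (c r x : K) :
    x ∈ B.openBall c r ↔ A.valuation (x - c) < A.valuation r := by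
  simp only [openBall, AbsLT, Set.mem_ofPred_eq, absLE_iff hB]
  exact ⟨fun h => not_le.1 h.2, fun h => ⟨h.le, h.not_ge⟩⟩

/-- By the ultrametric inequality every point of a ball is a center of it, with the same radius; so
the generating balls already form a base. -/
theorem isOpen_iff (s : Set K) :
    IsOpen[B.topology] s ↔ ∀ c ∈ s, ∃ r ≠ 0, B.openBall c r ⊆ s := by
  constructor
  · intro h
    induction h with
    | basic s hs =>
      obtain ⟨c', r, hr, rfl⟩ := hs
      refine fun c hc => ⟨r, hr, fun x hx => ?_⟩
      rw [mem_openBall_iff hB] at *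
      rw [← sub_add_sub_cancel x c c']
      exact A.valuation.map_add_lt hx hc
    | univ => exact fun c _ => ⟨1, one_ne_zero, Set.subset_univ _⟩
    | inter s t _ _ hs ht =>
      rintro c ⟨hcs, hct⟩
      obtain ⟨r₁, h₁, hs⟩ := hs c hcs
      obtain ⟨r₂, h₂, ht⟩ := ht c hct
      rcases le_total (A.valuation r₁) (A.valuation r₂) with h | h
      · refine ⟨r₁, h₁, fun x hx => ⟨hs hx, ht ?_⟩⟩
        rw [mem_openBall_iff hB] at *
        exact hx.trans_le h
      · refine ⟨r₂, h₂, fun x hx => ⟨hs ?_, ht hx⟩⟩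
        rw [mem_openBall_iff hB] at *
        exact hx.trans_le h
    | sUnion S _ ih =>
      rintro c ⟨s, hs, hc⟩
      obtain ⟨r, hr, h⟩ := ih s hs c hc
      exact ⟨r, hr, h.trans (Set.subset_sUnion_of_mem hs)⟩
  · intro h
    choose! r hr hs using h
    have : s = ⋃₀ {T | ∃ c ∈ s, T = B.openBall c (r c)} := by
      ext x
      refine ⟨fun hx => ⟨_, ⟨x, hx, rfl⟩, ?_⟩, ?_⟩
      · rw [mem_openBall_iff hB, sub_self, map_zero, zero_lt_iff, A.valuation.ne_zero_iff]
        exact hr x hx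
      · rintro ⟨_, ⟨c, hc, rfl⟩, hx⟩
        exact hs c hc hx
    rw [this]
    refine .sUnion _ ?_
    rintro _ ⟨c, hc, rfl⟩
    exact .basic _ ⟨c, r c, hr c hc, rfl⟩

theorem hasBasis_nhds (c : K) :
    (@nhds K B.topology c).HasBasis (fun r : K => r ≠ 0) (B.openBall c) := by
  refine ⟨fun t => ?_⟩
  rw [@mem_nhds_iff K B.topology c t]
  constructor
  · rintro ⟨s, hst, hs, hc⟩
    obtain ⟨r, hr, h⟩ := (isOpen_iff hB s).1 hs c hc
    exact ⟨r, hr, h.trans hst⟩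
  · rintro ⟨r, hr, h⟩
    refine ⟨_, h, .basic _ ⟨c, r, hr, rfl⟩, ?_⟩
    rw [mem_openBall_iff hB, sub_self, map_zero, zero_lt_iff, A.valuation.ne_zero_iff]
    exact hr

end Valued

end UnitBall

/-! ### Definability of ring operations. -/

section RingDefinable

variable {K : Type*} [Field K] [FirstOrder.Ring.CompatibleRing K]
  {L : Language} [L.Structure K] (φ : Language.ring →ᴸ L) [φ.IsExpansionOn K]
  {S : Set K} {α : Type*} {f g : (α → K) → K}
include φ

theorem Set.DefinableFun.ring_add (hf : S.DefinableFun L f) (hg : S.DefinableFun L g) :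
    S.DefinableFun L (fun v => f v + g v) := by
  have h := DefinableFun.comp (A := S) (L := L) (f := Language.Structure.funMap
    (φ.onFunction Ring.addFunc)) (g := fun v => ![f v, g v]) (by simp [DefinableMap, *])
    (.of_empty (.fun_symbol _))
  simpa using h

theorem Set.DefinableFun.ring_mul (hf : S.DefinableFun L f) (hg : S.DefinableFun L g) :
    S.DefinableFun L (fun v => f v * g v) := by
  have h := DefinableFun.comp (A := S) (L := L) (f := Language.Structure.funMap
    (φ.onFunction Ring.mulFunc)) (g := fun v => ![f v, g v]) (by simp [DefinableMap, *])
    (.of_empty (.fun_symbol _))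
  simpa using h

theorem Set.DefinableFun.ring_pow (hf : (Set.univ : Set K).DefinableFun L f) (n : ℕ) :
    (Set.univ : Set K).DefinableFun L (fun v => f v ^ n) := by
  induction n with
  | zero => simpa using L.definableFun_const α (Set.mem_univ (1 : K))
  | succ n ih => simpa only [pow_succ] using ih.ring_mul φ hf

end RingDefinable

/-! ### Classes of values modulo `k`: disjointness. -/

section Separation

variable {K : Type*} [Field K]

/-- The set of `x ≠ p₀` with `v (x - p₀) ∈ i • v π + k • v(Kˣ)`. -/
def valuationClass (A : ValuationSubring K) (p₀ π : K) (k i : ℕ) : Set K :=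
  {x | x ≠ p₀ ∧ ∃ y, A.valuation (x - p₀) = A.valuation (π ^ i * y ^ k)}

/-- Moving `c` by less than its distance to `p₀` leaves the valuation of `c - p₀` unchanged. This
makes the classes clopen away from `p₀`. -/
theorem mem_valuationClass_of_near {A : ValuationSubring K} {p₀ π x c : K} {k i : ℕ}
    (h : A.valuation (x - c) < A.valuation (c - p₀)) :
    x ∈ valuationClass A p₀ π k i ↔ c ∈ valuationClass A p₀ π k i := by
  have e : A.valuation (x - p₀) = A.valuation (c - p₀) := by
    rw [← sub_add_sub_cancel x c p₀]
    exact A.valuation.map_add_eq_of_lt_right h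
  have hne : x ≠ p₀ ↔ c ≠ p₀ := by
    rw [← sub_ne_zero, ← A.valuation.ne_zero_iff, e, A.valuation.ne_zero_iff, sub_ne_zero]
  simp only [valuationClass, Set.mem_ofPred_eq, hne, e]

/-- If `i < j`, then `(y / z) ^ k = p ^ (j - i)` with `0 < j - i < k`. So `y / z < 1`, hence `y / z
≤ p` and `p ^ (j - i) ≤ p ^ k`, which is impossible for `p < 1`. -/
theorem not_lt_of_mul_pow_eq {Γ : Type*} [LinearOrderedCommGroupWithZero Γ] {p y z : Γ}
    {i j k : ℕ} (hp0 : p ≠ 0) (hp : p < 1) (hmin : ∀ a : Γ, a < 1 → a ≤ p) (hy : y ≠ 0)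
    (hj : j < k) (h : p ^ i * y ^ k = p ^ j * z ^ k) : ¬ i < j := by
  intro hij
  obtain ⟨d, rfl⟩ := Nat.exists_eq_add_of_lt hij
  have hk : k ≠ 0 := by omega
  have e : y ^ k = p ^ (d + 1) * z ^ k := by
    rw [add_assoc, pow_add, mul_assoc] at h
    exact mul_left_cancel₀ (pow_ne_zero i hp0) h
  have hz : z ≠ 0 := by
    rintro rfl
    rw [zero_pow hk, mul_zero] at e
    exact pow_ne_zero k hy e
  have e' : (y / z) ^ k = p ^ (d + 1) := by
    rw [div_pow, e, mul_div_assoc, div_self (pow_ne_zero k hz), mul_one]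
  have h1 : y / z < 1 := by
    by_contra hge
    have := one_le_pow_of_one_le' (not_lt.1 hge) k
    rw [e'] at this
    exact absurd this (pow_lt_one₀ zero_le hp d.succ_ne_zero).not_ge
  have h2 : p ^ (d + 1) ≤ p ^ k := e' ▸ pow_le_pow_left₀ zero_le (hmin _ h1) k
  exact absurd h2 (pow_lt_pow_right_of_lt_one₀ (zero_lt_iff.2 hp0) hp (by omega)).not_ge

theorem disjoint_valuationClass {A : ValuationSubring K} {p₀ π : K} {k i j : ℕ}
    (hπ0 : π ≠ 0) (hπ : A.valuation π < 1)
    (hmin : ∀ a, A.valuation a < 1 → A.valuation a ≤ A.valuation π)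
    (hi : i < k) (hj : j < k) (hij : i ≠ j) :
    Disjoint (valuationClass A p₀ π k i) (valuationClass A p₀ π k j) := by
  rw [Set.disjoint_left]
  rintro x ⟨hx, y, hy⟩ ⟨-, z, hz⟩
  have hp0 : A.valuation π ≠ 0 := A.valuation.ne_zero_iff.2 hπ0
  have hmin' (a : A.ValueGroup) (ha : a < 1) : a ≤ A.valuation π := by
    obtain ⟨a, rfl⟩ := A.valuation_surjective a
    exact hmin a ha
  have hne : A.valuation (x - p₀) ≠ 0 := A.valuation.ne_zero_iff.2 (sub_ne_zero.2 hx)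
  simp only [map_mul, map_pow] at hy hz
  have hk : k ≠ 0 := by omega
  have hy0 : A.valuation y ≠ 0 := by
    intro h
    rw [h, zero_pow hk, mul_zero] at hy
    exact hne hy
  have hz0 : A.valuation z ≠ 0 := by
    intro h
    rw [h, zero_pow hk, mul_zero] at hz
    exact hne hz
  have e := hy.symm.trans hz
  rcases hij.lt_or_gt with h | h
  · exact not_lt_of_mul_pow_eq hp0 hπ hmin' hy0 hj e h
  · exact not_lt_of_mul_pow_eq hp0 hπ hmin' hz0 hi e.symm h

/-! ### Continuity and accumulation for the classes. -/

variable {B : UnitBall K} {A : ValuationSubring K} (hB : B.carrier = (A : Set K))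
include hB

theorem UnitBall.continuousAt_of_valuation {f : K → K} {c : K}
    (h : ∀ r ≠ 0, ∃ d ≠ 0, ∀ x, A.valuation (x - c) < A.valuation d →
      A.valuation (f x - f c) < A.valuation r) :
    @ContinuousAt K K B.topology B.topology f c := by
  let _ := B.topology
  refine ((hasBasis_nhds hB c).tendsto_iff (hasBasis_nhds hB (f c))).2 fun r hr => ?_
  obtain ⟨d, hd, hd'⟩ := h r hr
  refine ⟨d, hd, fun x hx => ?_⟩
  rw [mem_openBall_iff hB] at *
  exact hd' x hx

open Classical in
theorem continuousAt_valuationClass_indicator {p₀ π c : K} {k i : ℕ} (hc : c ≠ p₀) :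
    @ContinuousAt K K B.topology B.topology
      (fun x => if x ∈ valuationClass A p₀ π k i then (1 : K) else 0) c := by
  refine UnitBall.continuousAt_of_valuation hB fun r hr =>
    ⟨c - p₀, sub_ne_zero.2 hc, fun x hx => ?_⟩
  simp only [mem_valuationClass_of_near hx, sub_self, map_zero]
  exact zero_lt_iff.2 (A.valuation.ne_zero_iff.2 hr)

open Classical in
theorem continuousAt_vanishing_on_valuationClass {p₀ π : K} {k i : ℕ} (c : K) :
    @ContinuousAt K K B.topology B.topology
      (fun x => if x ∈ valuationClass A p₀ π k i then 0 else x - p₀) c := by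
  refine UnitBall.continuousAt_of_valuation hB fun r hr => ?_
  have hr' : 0 < A.valuation r := zero_lt_iff.2 (A.valuation.ne_zero_iff.2 hr)
  by_cases hc : c = p₀
  · subst hc
    refine ⟨r, hr, fun x hx => ?_⟩
    by_cases h : x ∈ valuationClass A c π k i <;> simp [h, hr', hx]
  -- Away from `p₀`, the second bound keeps `x` in the same branch as `c`, and the first controls `x
  -- - p₀`; the smaller of the two radii gives both.
  · have key (x : K) (h₁ : A.valuation (x - c) < A.valuation r)
        (h₂ : A.valuation (x - c) < A.valuation (c - p₀)) :
        A.valuation ((if x ∈ valuationClass A p₀ π k i then 0 else x - p₀) -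
          (if c ∈ valuationClass A p₀ π k i then 0 else c - p₀)) < A.valuation r := by
      by_cases h : c ∈ valuationClass A p₀ π k i <;>
        simp [mem_valuationClass_of_near h₂, h, hr', h₁]
    rcases le_total (A.valuation r) (A.valuation (c - p₀)) with h | h
    · exact ⟨r, hr, fun x hx => key x hx (hx.trans_le h)⟩
    · exact ⟨c - p₀, sub_ne_zero.2 hc, fun x hx => key x (hx.trans_le h) hx⟩

theorem accPt_valuationClass {p₀ π : K} {k i : ℕ} (hk : 0 < k) (hπ0 : π ≠ 0)
    (hπ : A.valuation π < 1) {U : Set K} (hU : U ∈ @nhds K B.topology p₀) :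
    @AccPt K B.topology p₀ (Filter.principal (U ∩ valuationClass A p₀ π k i)) := by
  let _ := B.topology
  rw [accPt_iff_nhds]
  intro t ht
  obtain ⟨r, hr, hrt⟩ := (UnitBall.hasBasis_nhds hB p₀).mem_iff.1 (Filter.inter_mem ht hU)
  have hp0 : A.valuation π ≠ 0 := A.valuation.ne_zero_iff.2 hπ0
  have hr0 : 0 < A.valuation r := zero_lt_iff.2 (A.valuation.ne_zero_iff.2 hr)
  -- The bound by `1` ensures that `π ^ i * y ^ k` is no larger than `y`, so `p₀ + π ^ i * y ^ k` is
  -- a point of the class in the ball.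
  obtain ⟨y, hy0, hyr, hy1⟩ :
      ∃ y ≠ 0, A.valuation y < A.valuation r ∧ A.valuation y ≤ 1 := by
    rcases le_or_gt (A.valuation r) 1 with h | h
    · have : A.valuation (r * π) < A.valuation r := by
        rw [map_mul]
        exact mul_lt_of_lt_one_right hr0 hπ
      exact ⟨r * π, mul_ne_zero hr hπ0, this, this.le.trans h⟩
    · exact ⟨π, hπ0, hπ.trans h, hπ.le⟩
  have hx0 : π ^ i * y ^ k ≠ 0 := mul_ne_zero (pow_ne_zero i hπ0) (pow_ne_zero k hy0)
  have hx : p₀ + π ^ i * y ^ k ∈ B.openBall p₀ r := by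
    rw [UnitBall.mem_openBall_iff hB, add_sub_cancel_left, map_mul, map_pow, map_pow]
    calc A.valuation π ^ i * A.valuation y ^ k ≤ A.valuation y ^ k :=
          mul_le_of_le_one_left' (pow_le_one₀ zero_le hπ.le)
      _ ≤ A.valuation y := pow_le_of_le_one zero_le hy1 hk.ne'
      _ < A.valuation r := hyr
  exact ⟨_, ⟨(hrt hx).1, (hrt hx).2, by simpa using hx0, y, by rw [add_sub_cancel_left]⟩,
    by simpa using hx0⟩

/-- Equal valuations mean equality up to a unit of `𝒪`. Quantifying over the root `u 0`, the unit `u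
1` and its inverse `u 2` leaves a formula in ring operations and `𝒪` alone. -/
theorem mem_valuationClass_iff {p₀ π x : K} {k i : ℕ} :
    x ∈ valuationClass A p₀ π k i ↔ x ≠ p₀ ∧ ∃ u : Fin 3 → K,
      x = p₀ + π ^ i * u 0 ^ k * u 1 ∧ u 1 * u 2 = 1 ∧ u 1 ∈ B.carrier ∧ u 2 ∈ B.carrier := by
  refine and_congr_right fun _ => ?_
  simp only [A.valuation_eq_iff, hB]
  constructor
  · rintro ⟨y, a, ha⟩
    refine ⟨![y, ((a : A) : K), ((a⁻¹ : Aˣ) : A)], ?_, ?_, (a : A).2, ((a⁻¹ : Aˣ) : A).2⟩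
    · simp only [Matrix.cons_val_zero, Matrix.cons_val_one]
      rw [mul_comm _ (((a : A) : K)), ha, add_sub_cancel]
    · exact congrArg Subtype.val a.mul_inv
  · rintro ⟨u, hx, h1, hu, hu'⟩
    refine ⟨u 0, ⟨⟨u 1, hu⟩, ⟨u 2, hu'⟩, Subtype.ext h1, Subtype.ext ?_⟩, ?_⟩
    · exact (mul_comm _ _).trans h1
    · rw [hx, add_sub_cancel_left, mul_comm]

end Separation

/-! ### Definability of the classes and of graphs. -/

section Definability

open Set

variable {K : Type*} [Field K] {B : UnitBall K} {L : Language} [L.Structure K]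

theorem definable_rel_preimage {α : Type*} {P : L.Relations 1}
    (hP : ∀ x : Fin 1 → K, Language.Structure.RelMap P x ↔ x 0 ∈ B.carrier)
    {f : (α → K) → K} (hf : (univ : Set K).DefinableFun L f) :
    (univ : Set K).Definable L {v | f v ∈ B.carrier} := by
  have h : (univ : Set K).Definable L {x : Fin 1 → K | x 0 ∈ B.carrier} := by
    refine (empty_definable_iff.2
      ⟨P.formula₁ (Language.Term.var 0), ?_⟩ : (∅ : Set K).Definable L _).mono (empty_subset _)
    ext x
    simp [hP]
  exact h.preimage_map (F := fun v _ => f v) fun _ => hf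

theorem definable₁_valuationClass [FirstOrder.Ring.CompatibleRing K]
    (φ : Language.ring →ᴸ L) [φ.IsExpansionOn K] {P : L.Relations 1}
    (hP : ∀ x : Fin 1 → K, Language.Structure.RelMap P x ↔ x 0 ∈ B.carrier)
    {A : ValuationSubring K} (hB : B.carrier = (A : Set K)) (p₀ π : K) (k i : ℕ) :
    (univ : Set K).Definable₁ L (valuationClass A p₀ π k i) := by
  simp only [Definable₁, mem_valuationClass_iff hB]
  have hc {α : Type} (a : K) : (univ : Set K).DefinableFun L (fun _ : α → K => a) :=
    L.definableFun_const α (mem_univ a)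
  have hv {α : Type} (j : α) : (univ : Set K).DefinableFun L (fun v : α → K => v j) :=
    DefinableFun.proj L
  have h₁ := DefinableFun.ofPred_eq (hv (Sum.inl 0 : Fin 1 ⊕ Fin 3))
    ((hc p₀).ring_add φ (((hc (π ^ i)).ring_mul φ ((hv (Sum.inr 0)).ring_pow φ k)).ring_mul φ
      (hv (Sum.inr 1))))
  have h₂ := DefinableFun.ofPred_eq
    ((hv (Sum.inr 1 : Fin 1 ⊕ Fin 3)).ring_mul φ (hv (Sum.inr 2))) (hc 1)
  have h₃ := definable_rel_preimage hP (hv (Sum.inr 1 : Fin 1 ⊕ Fin 3))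
  have h₄ := definable_rel_preimage hP (hv (Sum.inr 2 : Fin 1 ⊕ Fin 3))
  exact (DefinableFun.ofPred_eq_const (hv (0 : Fin 1)) (mem_univ p₀)).compl.inter
    ((h₁.inter (h₂.inter (h₃.inter h₄))).exists_of_finite)

theorem definable₂_graph {K : Type*} {L : Language} [L.Structure K] {X : Set K} (hX : (univ : Set K).Definable₁ L X) {f : K → K}
    (hf : (univ : Set K).DefinableFun L fun v : Fin 1 → K => f (v 0)) :
    (univ : Set K).Definable₂ L {p : K × K | p.1 ∈ X ∧ f p.1 = p.2} := by
  have h : (univ : Set K).DefinableFun L fun v : Fin 2 → K => f (v 0) :=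
    DefinableFun.comp (g := fun (v : Fin 2 → K) (_ : Fin 1) => v 0)
      (fun _ => DefinableFun.proj L) hf
  exact (Set.Definable.preimage_comp (fun _ : Fin 1 => (0 : Fin 2)) hX).inter
    (h.ofPred_eq (DefinableFun.proj L (i := (1 : Fin 2))))

end Definability

/-! ### The proposition. -/

/-- `K` is an ordered or valued field with unit ball `B`, and `L` is a language extending the
language of rings (via `φ`) with a unary predicate symbol `P`; `K` is an `L`-structure in which the
ring symbols have their usual meaning and `P` is interpreted by the unit ball. -/
theorem proposition6p6 {K : Type*} [Field K] (B : UnitBall K)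
    (L : Language) [L.Structure K]
    [FirstOrder.Ring.CompatibleRing K]
    (φ : Language.ring →ᴸ L) [φ.IsExpansionOn K]
    (P : L.Relations 1)
    (hP : ∀ x : Fin 1 → K, Language.Structure.RelMap P x ↔ x 0 ∈ B.carrier)
    (hZ : ConditionZ B L)
    (U : Set K) (hU : (Set.univ : Set K).Definable₁ L U) (hUo : IsOpen[B.topology] U)
    (p₀ : K) (hp₀ : p₀ ∈ U) :
    HasArbitrarilyManyGerms B L U p₀ := by
  classical
  obtain ⟨π, ⟨hπ, hπ'⟩, hmin⟩ := B.exists_uniformizer hZ.1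
  rcases B.ordered_or_valued with ⟨_, _, hB⟩ | ⟨A, -, hB⟩
  · exact (B.not_orderedField_of_uniformizer hB π hπ hπ' hmin).elim
  -- The multiplicative valuation reverses the order of `v(Kˣ)`: least positive value becomes
  -- largest valuation below `1`.
  have hlt (x : Kˣ) :
      A.valuation (x : K) < 1 ↔ (x : K) ∈ B.carrier ∧ (x : K)⁻¹ ∉ B.carrier := by
    have hx : 0 < A.valuation (x : K) := zero_lt_iff.2 (A.valuation.ne_zero_iff.2 x.ne_zero)
    rw [UnitBall.mem_carrier_iff hB, UnitBall.mem_carrier_iff hB, map_inv₀, inv_le_one₀ hx, not_le]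
    exact ⟨fun h => ⟨h.le, h⟩, And.right⟩
  have hπ1 : A.valuation (π : K) < 1 := (hlt π).2 ⟨hπ, hπ'⟩
  have hπmin (a : K) (ha : A.valuation a < 1) : A.valuation a ≤ A.valuation (π : K) := by
    by_cases ha0 : a = 0
    · rw [ha0, map_zero]
      exact zero_le
    · have h := (hlt (Units.mk0 a ha0)).1 ha
      exact (UnitBall.absLE_iff hB _ _).1 (hmin _ h.1 h.2)
  intro k hk
  let D (i : Fin k) : Set K := valuationClass A p₀ π k i
  have hDdef (i : Fin k) : (Set.univ : Set K).Definable L {v : Fin 1 → K | v 0 ∈ D i} :=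
    definable₁_valuationClass φ hP hB p₀ π k i
  have hp₀D (i : Fin k) : p₀ ∉ D i := fun h => h.1 rfl
  have hnhds : U ∈ @nhds K B.topology p₀ := @IsOpen.mem_nhds K B.topology p₀ U hUo hp₀
  have hc (a : K) : (Set.univ : Set K).DefinableFun L (fun _ : Fin 1 → K => a) :=
    L.definableFun_const _ (Set.mem_univ a)
  have hv : (Set.univ : Set K).DefinableFun L (fun v : Fin 1 → K => v 0) :=
    Set.DefinableFun.proj L
  have hUp : (Set.univ : Set K).Definable₁ L (U \ {p₀}) :=
    Set.Definable.sdiff hU (hv.ofPred_eq_const (Set.mem_univ p₀))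
  let s (i : Fin k) (x : K) : K := if x ∈ D i then 0 else x - p₀
  let δ (i : Fin k) (x : K) : K := if x ∈ D i then 1 else 0
  have hS (i : Fin k) : {x | x ∈ U ∧ s i x = 0} \ {p₀} ⊆ D i := by
    rintro x ⟨⟨-, hx⟩, hne⟩
    by_contra hxD
    exact hne (sub_eq_zero.1 ((if_neg hxD).symm.trans hx))
  have hdisj (i j : Fin k) (hij : i ≠ j) : Disjoint (D i) (D j) :=
    disjoint_valuationClass π.ne_zero hπ1 hπmin i.2 j.2 (Fin.val_ne_of_ne hij)
  -- The neighborhood is `U` itself for every `k`, and `1` bounds every `δ i`, whose values are `0`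
  -- and `1`.
  refine ⟨U, subset_rfl, hp₀, @mem_nhdsWithin_of_mem_nhds K B.topology _ _ _ hnhds, hU, s,
    fun i => ⟨fun x _ => ?_, ?_⟩, δ, fun i => ⟨fun x hx => ?_, ?_⟩, fun i j hij => ?_,
    fun i => ⟨?_, ?_⟩, fun i j hij => ⟨fun x hx => ?_, fun x hx => ?_⟩, fun i => ⟨1, fun x _ => ?_⟩⟩
  · exact @ContinuousAt.continuousWithinAt K K B.topology B.topology _ _ _
      (continuousAt_vanishing_on_valuationClass hB x)
  · refine definable₂_graph hU (.ite (hDdef i) (hc 0) ?_)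
    simpa only [sub_eq_add_neg] using hv.ring_add φ (hc (-p₀))
  · exact @ContinuousAt.continuousWithinAt K K B.topology B.topology _ _ _
      (continuousAt_valuationClass_indicator hB hx.2)
  · exact definable₂_graph hUp (.ite (hDdef i) (hc 1) (hc 0))
  · exact (hdisj i j hij).mono (hS i) (hS j)
  · exact (if_neg (hp₀D i)).trans (sub_self p₀)
  · exact @AccPt.mono K B.topology _ _ _ (accPt_valuationClass hB hk π.ne_zero hπ1 hnhds)
      (Filter.principal_mono.2 fun x hx => ⟨hx.1, if_pos hx.2⟩)
  · exact if_pos (hS i hx)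
  · exact if_neg (Set.disjoint_right.1 (hdisj i j hij) (hS j hx))
  · rw [UnitBall.absLE_iff hB]
    by_cases h : x ∈ D i <;> simp [δ, h]
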